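/- **Instability of the bound state.** Let $(\Omega,\mathbb P)$ be a probability space endowed with a measurable action $\tau=(\tau_x)_{x\in\mathbb R^d}$ of the group $(\mathbb R^d,+)$: each $\tau_x$ preserves $\mathbb P$ and $(x,\omega)\mapsto\tau_x\omega$ is jointly measurable. On $\operatorname{L}^2(\Omega)=\operatorname{L}^2(\Omega;\mathbb C)$ set $T_x\phi:=\phi(\tau_{-x}\,\cdot)$, let $\nabla^{\operatorname{st}}=(\partial_i^{\operatorname{st}})_{1\le i\le d}$ be the stationary gradient, $\partial^{\operatorname{st}}_i\phi:=\lim_{h\to0}\frac1h(T_{he_i}\phi-\phi)$ in $\operatorname{L}^2(\Omega)$, let $H^1(\Omega)$ be its domain, let $H^2(\Omega):=\{\phi\in H^1(\Omega):\partial^{\operatorname{st}}_i\phi\in H^1(\Omega)\ \forall i\}$, and let $\triangle^{\operatorname{st}}:=\sum_i\partial_i^{\operatorname{st}}\partial_i^{\operatorname{st}}$. Let $V\in\operatorname{L}^2(\Omega;\mathbb R)$ with $\mathbb E[V]=0$, viewed as the centered stationary random field $V(x,\omega)=V(\tau_{-x}\omega)$, and denote by $\widehat{\mathcal C}$ the (nonnegative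 finite measure) Fourier transform of its covariance function $\mathcal C(x):=\mathbb E[V(x,\cdot)V(0,\cdot)]$, normalized by $\mathcal C(x)=(2\pi)^{-d}\int_{\mathbb R^d}e^{ix\cdot y}\,d\widehat{\mathcal C}(y)$ for all $x\in\mathbb R^d$. For $k\in\mathbb R^d$ and $\lambda\ge0$, let $$H_{k,\lambda}^{\operatorname{st}}:=-\triangle^{\operatorname{st}}-2ik\cdot\nabla^{\operatorname{st}}+\lambda V$$ be the fibered Schrödinger operator on $\operatorname{L}^2(\Omega)$ with its maximal domain, that is, the adjoint of the symmetric operator given by this formula on $H^2(\Omega)\cap\operatorname{L}^\infty(\Omega)$ (this is its unique self-adjoint extension whenever that symmetric operator is essentially self-adjoint, e.g. if $V$ is bounded, in which case its domain is $H^2(\Omega)$). Let $k\in\mathbb R^d\setminus\{0\}$ and assume that $\widehat{\mathcal C}$ does not uniformly vanish on the sphere $\partial B_{|k|}(-k)$, in the sense that the following limit exists in $[0,\infty]$ and is positive: $$\lim_{\varepsilon\downarrow0}\tfrac1\varepsilon\,\widehat{\mathcal C}\big(B_{|k|+\varepsilon}(-k)\setminus B_{|k|-\varepsilon}(-k)\big)>0,$$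 where $B_r(x)$ denotes the open ball of radius $r$ centered at $x$. Then for no $\delta>0$ does there exist a branch $[0,\delta)\to\mathbb R\times\operatorname{L}^2(\Omega):\lambda\mapsto(E_{k,\lambda},\psi_{k,\lambda})$ of class $C^2$ such that, for all $\lambda\in[0,\delta)$, $\psi_{k,\lambda}$ belongs to the domain of $H_{k,\lambda}^{\operatorname{st}}$ and $$H_{k,\lambda}^{\operatorname{st}}\psi_{k,\lambda}=E_{k,\lambda}\psi_{k,\lambda},\qquad\text{with}\qquad(E_{k,\lambda},\psi_{k,\lambda})|_{\lambda=0}=(0,1).$$ -/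

import Mathlib

open MeasureTheory Filter Topology Set
open scoped ENNReal

noncomputable section

namespace StationaryRandom

/-- The Euclidean space `ℝ^d`. -/
abbrev Rd (d : ℕ) : Type := EuclideanSpace ℝ (Fin d)

section Calculus

variable {d : ℕ} {Ω : Type*} [MeasurableSpace Ω] [AddAction (Rd d) Ω] [MeasurableVAdd₂ (Rd d) Ω]
  (P : Measure Ω) [VAddInvariantMeasure (Rd d) Ω P]

/-- The unitary translation `T_x φ = φ(τ_{-x} ·)` on `L²(Ω)`, where `τ_x ω = x +ᵥ ω`. -/
def translation (x : Rd d) : Lp ℂ 2 P →ₗᵢ[ℂ] Lp ℂ 2 P :=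
  Lp.compMeasurePreservingₗᵢ ℂ (fun ω : Ω => -x +ᵥ ω) (measurePreserving_vadd (-x) P)

/-- The orbit `h ↦ T_{h e_i} φ`, for `h` real. -/
def orbit (i : Fin d) (φ : Lp ℂ 2 P) (h : ℝ) : Lp ℂ 2 P :=
  translation P (EuclideanSpace.single i h) φ

/-- The `i`-th component `∂_i^st` of the stationary gradient `∇^st`, that is, the infinitesimal
generator of `h ↦ T_{h e_i}`: `∂_i^st φ = lim_{h → 0} (T_{h e_i} φ - φ) / h` in `L²(Ω)`. It is only
meaningful on its domain `partialDomain P i`. -/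
def stPartial (i : Fin d) (φ : Lp ℂ 2 P) : Lp ℂ 2 P := deriv (orbit P i φ) 0

theorem orbit_add (i : Fin d) (φ ψ : Lp ℂ 2 P) :
    orbit P i (φ + ψ) = fun h => orbit P i φ h + orbit P i ψ h := by
  funext h; simp [orbit]

theorem orbit_smul (i : Fin d) (c : ℂ) (φ : Lp ℂ 2 P) :
    orbit P i (c • φ) = fun h => c • orbit P i φ h := by
  funext h; simp [orbit]

/-- The domain of `∂_i^st`: the elements of `L²(Ω)` for which the limit defining `∂_i^st φ`
exists in `L²(Ω)`. -/
def partialDomain (i : Fin d) : Submodule ℂ (Lp ℂ 2 P) where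
  carrier := {φ | DifferentiableAt ℝ (orbit P i φ) 0}
  zero_mem' := by
    have h : orbit P i (0 : Lp ℂ 2 P) = fun _ => 0 := by funext h; simp [orbit]
    simp [h]
  add_mem' := by
    intro φ ψ hφ hψ
    simp only [mem_ofPred_eq] at *
    rw [orbit_add]
    exact hφ.add hψ
  smul_mem' := by
    intro c φ hφ
    simp only [mem_ofPred_eq] at *
    rw [orbit_smul]
    exact hφ.const_smul c

theorem stPartial_add (i : Fin d) {φ ψ : Lp ℂ 2 P} (hφ : φ ∈ partialDomain P i)
    (hψ : ψ ∈ partialDomain P i) :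
    stPartial P i (φ + ψ) = stPartial P i φ + stPartial P i ψ := by
  unfold stPartial
  rw [orbit_add]
  exact deriv_fun_add hφ hψ

theorem stPartial_smul (i : Fin d) (c : ℂ) {φ : Lp ℂ 2 P} (hφ : φ ∈ partialDomain P i) :
    stPartial P i (c • φ) = c • stPartial P i φ := by
  unfold stPartial
  rw [orbit_smul]
  exact deriv_fun_const_smul c hφ

/-- `H¹(Ω)`: the domain of the stationary gradient. -/
def H1 : Submodule ℂ (Lp ℂ 2 P) := ⨅ i : Fin d, partialDomain P i

theorem mem_partialDomain_of_mem_H1 {φ : Lp ℂ 2 P} (h : φ ∈ H1 (d := d) P) (i : Fin d) :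
    φ ∈ partialDomain P i :=
  (Submodule.mem_iInf _).1 h i

/-- `H²(Ω)`: the elements of `H¹(Ω)` all of whose stationary derivatives are in `H¹(Ω)`. -/
def H2 : Submodule ℂ (Lp ℂ 2 P) where
  carrier := {φ | φ ∈ H1 (d := d) P ∧ ∀ i : Fin d, stPartial P i φ ∈ H1 (d := d) P}
  zero_mem' := by
    refine ⟨Submodule.zero_mem _, fun i => ?_⟩
    have h := stPartial_smul P i 0 (Submodule.zero_mem (partialDomain P i))
    rw [zero_smul, zero_smul] at h
    rw [h]
    exact Submodule.zero_mem _
  add_mem' := by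
    rintro φ ψ ⟨hφ, hφ'⟩ ⟨hψ, hψ'⟩
    refine ⟨Submodule.add_mem _ hφ hψ, fun i => ?_⟩
    rw [stPartial_add P i (mem_partialDomain_of_mem_H1 P hφ i)
      (mem_partialDomain_of_mem_H1 P hψ i)]
    exact Submodule.add_mem _ (hφ' i) (hψ' i)
  smul_mem' := by
    rintro c φ ⟨hφ, hφ'⟩
    refine ⟨Submodule.smul_mem _ c hφ, fun i => ?_⟩
    rw [stPartial_smul P i c (mem_partialDomain_of_mem_H1 P hφ i)]
    exact Submodule.smul_mem _ c (hφ' i)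

/-- The (centered) fibered Laplacian `H_{k,0}^st = -Δ^st - 2 i k · ∇^st` on `H²(Ω)`, where
`Δ^st = ∑ i, ∂_i^st ∂_i^st`. -/
def fiberedLaplacian (k : Rd d) : H2 (d := d) P →ₗ[ℂ] Lp ℂ 2 P where
  toFun := fun φ =>
    -(∑ i : Fin d, stPartial P i (stPartial P i (φ : Lp ℂ 2 P)))
      - (2 * Complex.I) • ∑ i : Fin d, (k i : ℂ) • stPartial P i (φ : Lp ℂ 2 P)
  map_add' := by
    intro φ ψ
    have h1 : ∀ i : Fin d, stPartial P i ((φ + ψ : H2 (d := d) P) : Lp ℂ 2 P)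
        = stPartial P i (φ : Lp ℂ 2 P) + stPartial P i (ψ : Lp ℂ 2 P) := fun i =>
      stPartial_add P i (mem_partialDomain_of_mem_H1 P φ.2.1 i)
        (mem_partialDomain_of_mem_H1 P ψ.2.1 i)
    have h2 : ∀ i : Fin d,
        stPartial P i (stPartial P i (φ : Lp ℂ 2 P) + stPartial P i (ψ : Lp ℂ 2 P))
        = stPartial P i (stPartial P i (φ : Lp ℂ 2 P))
          + stPartial P i (stPartial P i (ψ : Lp ℂ 2 P)) := fun i =>
      stPartial_add P i (mem_partialDomain_of_mem_H1 P (φ.2.2 i) i)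
        (mem_partialDomain_of_mem_H1 P (ψ.2.2 i) i)
    simp only [h1, h2, smul_add, Finset.sum_add_distrib]
    abel
  map_smul' := by
    intro c φ
    have h1 : ∀ i : Fin d, stPartial P i ((c • φ : H2 (d := d) P) : Lp ℂ 2 P)
        = c • stPartial P i (φ : Lp ℂ 2 P) := fun i =>
      stPartial_smul P i c (mem_partialDomain_of_mem_H1 P φ.2.1 i)
    have h2 : ∀ i : Fin d, stPartial P i (c • stPartial P i (φ : Lp ℂ 2 P))
        = c • stPartial P i (stPartial P i (φ : Lp ℂ 2 P)) := fun i =>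
      stPartial_smul P i c (mem_partialDomain_of_mem_H1 P (φ.2.2 i) i)
    simp only [h1, h2, RingHom.id_apply, smul_sub, smul_neg, Finset.smul_sum]
    simp only [smul_comm c]

/-- `L^∞(Ω)`, as a subspace of `L²(Ω)`. -/
def LInfty {Ω : Type*} [MeasurableSpace Ω] (P : Measure Ω) : Submodule ℂ (Lp ℂ 2 P) where
  carrier := {φ | MemLp φ ∞ P}
  zero_mem' := (memLp_congr_ae (Lp.coeFn_zero ℂ 2 P)).2 MemLp.zero
  add_mem' := fun {φ ψ} hφ hψ => (memLp_congr_ae (Lp.coeFn_add φ ψ)).2 (hφ.add hψ)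
  smul_mem' := fun c φ hφ => (memLp_congr_ae (Lp.coeFn_smul c φ)).2 (hφ.const_smul c)

theorem memLp_mul_of_mem_LInfty {Ω : Type*} [MeasurableSpace Ω] {P : Measure Ω} {V : Ω → ℝ}
    (hV : MemLp V 2 P) (φ : LInfty P) :
    MemLp (fun ω => (V ω : ℂ) * (φ : Lp ℂ 2 P) ω) 2 P :=
  MemLp.mul φ.2 hV.ofReal

/-- Multiplication by the potential `V ∈ L²(Ω)`, as a map from `L^∞(Ω)` to `L²(Ω)`. -/
def mulPotential {Ω : Type*} [MeasurableSpace Ω] {P : Measure Ω} {V : Ω → ℝ}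
    (hV : MemLp V 2 P) : LInfty P →ₗ[ℂ] Lp ℂ 2 P where
  toFun := fun φ => (memLp_mul_of_mem_LInfty hV φ).toLp _
  map_add' := by
    intro φ ψ
    rw [← MemLp.toLp_add, MemLp.toLp_eq_toLp_iff]
    filter_upwards [Lp.coeFn_add (φ : Lp ℂ 2 P) (ψ : Lp ℂ 2 P)] with ω h
    change (V ω : ℂ) * ((φ : Lp ℂ 2 P) + (ψ : Lp ℂ 2 P) : Lp ℂ 2 P) ω = _
    rw [h, Pi.add_apply, mul_add]
    rfl
  map_smul' := by
    intro c φ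
    rw [RingHom.id_apply, ← MemLp.toLp_const_smul, MemLp.toLp_eq_toLp_iff]
    filter_upwards [Lp.coeFn_smul c (φ : Lp ℂ 2 P)] with ω h
    change (V ω : ℂ) * (c • (φ : Lp ℂ 2 P) : Lp ℂ 2 P) ω = c * ((V ω : ℂ) * (φ : Lp ℂ 2 P) ω)
    rw [h, Pi.smul_apply, smul_eq_mul, mul_left_comm]

/-- The symmetric operator `H_{k,0}^st + lam V` with domain `H²(Ω) ∩ L^∞(Ω)`. -/
def fiberedMinimal {V : Ω → ℝ} (hV : MemLp V 2 P) (k : Rd d) (lam : ℝ) :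
    Lp ℂ 2 P →ₗ.[ℂ] Lp ℂ 2 P where
  domain := H2 (d := d) P ⊓ LInfty P
  toFun := fiberedLaplacian P k ∘ₗ Submodule.inclusion inf_le_left
    + (lam : ℂ) • (mulPotential hV ∘ₗ Submodule.inclusion inf_le_right)

/-- The fibered Schrödinger operator `H_{k,lam}^st = H_{k,0}^st + lam V` on `L²(Ω)`, with its maximal
domain: all `u ∈ L²(Ω)` such that `H_{k,0}^st u + lam V u`, understood in duality with
`H²(Ω) ∩ L^∞(Ω)`, belongs to `L²(Ω)`. Equivalently, this is the adjoint of the symmetric operator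
defined on `H²(Ω) ∩ L^∞(Ω)`. When the latter is essentially self-adjoint (for instance when `V`
is bounded, and then the domain is `H²(Ω)`), this is its unique self-adjoint extension; in all
cases it extends every self-adjoint extension of that symmetric operator. -/
def fiberedSchrodinger {V : Ω → ℝ} (hV : MemLp V 2 P) (k : Rd d) (lam : ℝ) :
    Lp ℂ 2 P →ₗ.[ℂ] Lp ℂ 2 P :=
  (fiberedMinimal P hV k lam).adjoint

/-- The covariance function `C(x) = E[V(x, ·) V(0, ·)]` of the centered stationary random field
`V(x, ω) = V(τ_{-x} ω)`. -/
def covarianceFunction (V : Ω → ℝ) (x : Rd d) : ℝ :=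
  ∫ ω, V (-x +ᵥ ω) * V ω ∂P

end Calculus

/-- `ν` is a finite nonnegative measure which is the Fourier transform of `C`, in the normalization
`Ĉ(y) = ∫ e^{-i x · y} C(x) dx`, that is, `C(x) = (2π)^{-d} ∫ e^{i x · y} dν(y)`. -/
def IsFourierTransformOf {d : ℕ} (ν : Measure (Rd d)) (C : Rd d → ℝ) : Prop :=
  IsFiniteMeasure ν ∧
    ∀ x : Rd d, (C x : ℂ) = (((2 * Real.pi) ^ d : ℝ) : ℂ)⁻¹ * charFun ν x

theorem IsFourierTransformOf.unique {d : ℕ} {ν ν' : Measure (Rd d)} {C : Rd d → ℝ}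
    (h : IsFourierTransformOf ν C) (h' : IsFourierTransformOf ν' C) : ν = ν' := by
  have := h.1
  have := h'.1
  have hc : (((2 * Real.pi) ^ d : ℝ) : ℂ)⁻¹ ≠ 0 :=
    inv_ne_zero (Complex.ofReal_ne_zero.2 (by positivity))
  refine Measure.ext_of_charFun (funext fun x => mul_left_cancel₀ hc ?_)
  rw [← h.2 x, h'.2 x]

open Classical in
/-- The (nonnegative measure) Fourier transform `Ĉ` of a function `C`. It is unique, and exists
by Bochner's theorem when `C` is continuous and positive definite, in particular when `C` is a
covariance function; it is set to `0` if there is none. -/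
def fourierMeasure {d : ℕ} (C : Rd d → ℝ) : Measure (Rd d) :=
  if h : ∃ ν : Measure (Rd d), IsFourierTransformOf ν C then h.choose else 0

/-- The measure `ν` does not uniformly vanish on the sphere `∂B_r(c)`: the limit as `ε ↓ 0` of
`ε⁻¹ ν(B_{r+ε}(c) \ B_{r-ε}(c))` exists in `[0, ∞]` and is positive. -/
def NonvanishingOnSphere {d : ℕ} (ν : Measure (Rd d)) (c : Rd d) (r : ℝ) : Prop :=
  ∃ L : ℝ≥0∞, 0 < L ∧
    Tendsto (fun ε : ℝ => ν (Metric.ball c (r + ε) \ Metric.ball c (r - ε)) / ENNReal.ofReal ε)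
      (𝓝[>] 0) (𝓝 L)

end StationaryRandom

end

open scoped SchwartzMap LineDeriv FourierTransform ComplexConjugate

noncomputable section

namespace StationaryRandom

/-! ### Translations of Schwartz functions in `L¹` -/

section Schwartz

variable {E : Type*} [NormedAddCommGroup E] [NormedSpace ℝ E]

/-! A differentiable branch would force the spectral measure `ν` of `V` to be too small near the
sphere. Differentiating the eigenvalue equation at `λ = 0` and testing with `1` gives `E' = 𝔼[V] =
0`, so `ψ'` solves `H_{k,0} ψ' = -V` weakly (`exists_weak_corrector`). On the spectral side
`H_{k,0}` is multiplication by `|z + k|² - |k|²`, which vanishes on the sphere, so `V` cannot carry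
much mass there.

This is made quantitative without the spectral theorem. Choose a weight `f` whose transform is a
smooth cutoff to the shell `S_ε`, and test with `w = ∫ f(x) T_x V dx`. Then `⟨w, V⟩` is at least a
constant times `ν(S_ε)`, while the equation and Cauchy–Schwarz bound it by `‖H_{k,0} w‖ ‖ψ'‖`, which
is `O(ε ν(S_{4ε})^{1/2})`. The result is `ν(S_ε)² ≤ A ε² ν(S_{4ε})` (`measureReal_shell_sq_le`).
Applied twice to the finite measure `ν`, this gives first `ν(S_ε) = O(ε)`, then `O(ε^{3/2})`
(`tendsto_div_of_sq_le`), so the assumed positive limit would be zero.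

Two points need care. The adjoint is meaningful only because `H² ∩ L^∞` is dense
(`dense_H2_inf_LInfty`). And since `V` is merely in `L²`, `w` need not be an admissible test
function: the equation is tested on averages of bounded variables and passed to the limit
(`inner_integral_smul_translation_eq`). -/

theorem hasDerivAt_schwartz_sub_smul (f : 𝓢(E, ℂ)) (x v : E) (t : ℝ) :
    HasDerivAt (fun t : ℝ => f (x - t • v)) (-(∂_{v} f) (x - t • v)) t := by
  have h1 : HasDerivAt (fun t : ℝ => x - t • v) (-v) t := by
    simpa using ((hasDerivAt_id t).smul_const v).const_sub x
  have h2 := (f.differentiableAt (x := x - t • v)).hasFDerivAt.comp_hasDerivAt t h1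
  rw [map_neg] at h2
  exact h2

variable [FiniteDimensional ℝ E] [MeasurableSpace E] [BorelSpace E]

/-- Small translates of a Schwartz function along a direction have a common integrable bound. -/
theorem exists_integrable_bound_sub_smul (μ : Measure E) [μ.IsAddHaarMeasure]
    (f : 𝓢(E, ℂ)) (v : E) :
    ∃ b : E → ℝ, Integrable b μ ∧ ∀ x (t : ℝ), |t| ≤ 1 → ‖f (x - t • v)‖ ≤ b x := by
  set n : ℕ := Module.finrank ℝ E + 1
  obtain ⟨K, hK⟩ : ∃ K : ℝ, ∀ x, (1 + ‖x‖) ^ n * ‖f x‖ ≤ K :=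
    ⟨_, fun x => by
      simpa using SchwartzMap.one_add_le_sup_seminorm_apply (𝕜 := ℂ) (m := (n, 0)) le_rfl le_rfl f x⟩
  refine ⟨fun x => (1 + ‖x‖) ^ (-(n : ℝ)) * ((1 + ‖v‖) ^ n * K),
    (integrable_one_add_norm (by simp [n])).mul_const _, fun x t ht => ?_⟩
  -- Peetre's inequality, which transfers the decay of `f` at `x - t • v` to decay at `x`.
  have h1 : 1 + ‖x‖ ≤ (1 + ‖x - t • v‖) * (1 + ‖v‖) := by
    have h2 : ‖x‖ ≤ ‖x - t • v‖ + ‖t • v‖ := by simpa using norm_add_le (x - t • v) (t • v)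
    have h3 : ‖t • v‖ ≤ ‖v‖ := by
      rw [norm_smul, Real.norm_eq_abs]; exact mul_le_of_le_one_left (norm_nonneg _) ht
    nlinarith [mul_nonneg (norm_nonneg (x - t • v)) (norm_nonneg v)]
  have hx : 0 < (1 + ‖x‖) ^ n := by positivity
  beta_reduce
  rw [Real.rpow_neg (by positivity), Real.rpow_natCast, inv_mul_eq_div, le_div_iff₀' hx]
  calc (1 + ‖x‖) ^ n * ‖f (x - t • v)‖
      ≤ ((1 + ‖x - t • v‖) * (1 + ‖v‖)) ^ n * ‖f (x - t • v)‖ := by gcongr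
    _ = (1 + ‖v‖) ^ n * ((1 + ‖x - t • v‖) ^ n * ‖f (x - t • v)‖) := by rw [mul_pow]; ring
    _ ≤ (1 + ‖v‖) ^ n * K := by gcongr; exact hK _

/-- Translation is differentiable in `L¹` on Schwartz functions. -/
theorem tendsto_integral_norm_slope_translate (μ : Measure E) [μ.IsAddHaarMeasure]
    (f : 𝓢(E, ℂ)) (v : E) :
    Tendsto (fun h : ℝ => ∫ x, ‖h⁻¹ • (f (x - h • v) - f x) + (∂_{v} f) x‖ ∂μ) (𝓝[≠] 0) (𝓝 0) := by
  obtain ⟨b, hb, hfb⟩ := exists_integrable_bound_sub_smul μ (∂_{v} f) v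
  suffices Tendsto (fun h : ℝ => ∫ x, ‖h⁻¹ • (f (x - h • v) - f x) + (∂_{v} f) x‖ ∂μ) (𝓝[≠] 0)
      (𝓝 (∫ _ : E, (0 : ℝ) ∂μ)) by simpa only [integral_zero] using this
  refine tendsto_integral_filter_of_dominated_convergence (fun x => b x + b x) ?_ ?_ (hb.add hb) ?_
  · refine Eventually.of_forall fun h => Continuous.aestronglyMeasurable ?_
    have := f.continuous
    have := (∂_{v} f).continuous
    fun_prop
  · have h1 : ∀ᶠ h : ℝ in 𝓝[≠] 0, |h| ≤ 1 := by
      refine nhdsWithin_le_nhds ?_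
      filter_upwards [Metric.closedBall_mem_nhds (0 : ℝ) one_pos] with h hh
      simpa using hh
    filter_upwards [h1, self_mem_nhdsWithin] with h hh hh0
    refine Eventually.of_forall fun x => ?_
    -- Mean value inequality in `t`: the same `b x` bounds the difference quotient and, at `t = 0`,
    -- the derivative.
    have h2 := Convex.norm_image_sub_le_of_norm_hasDerivWithin_le (C := b x)
      (s := Icc (-1 : ℝ) 1) (x := 0) (y := h)
      (fun t _ => (hasDerivAt_schwartz_sub_smul f x v t).hasDerivWithinAt)
      (fun t ht => by rw [norm_neg]; exact hfb x t (abs_le.2 ht)) (convex_Icc _ _) (by simp)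
      (abs_le.1 hh)
    simp only [zero_smul, sub_zero, Real.norm_eq_abs] at h2
    rw [norm_norm]
    refine (norm_add_le _ _).trans (add_le_add ?_ (by simpa using hfb x 0 (by simp)))
    rw [norm_smul, norm_inv, Real.norm_eq_abs, inv_mul_le_iff₀ (abs_pos.2 hh0), mul_comm]
    exact h2
  · refine Eventually.of_forall fun x => ?_
    have h := hasDerivAt_iff_tendsto_slope_zero.1 (hasDerivAt_schwartz_sub_smul f x v 0)
    simp only [zero_add, zero_smul, sub_zero] at h
    have h' := (h.add_const ((∂_{v} f) x)).norm
    rwa [neg_add_cancel, norm_zero] at h'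

end Schwartz

/-! ### Averages of bounded random variables over translations -/

section Mollify

variable {d : ℕ} {Ω : Type*} [AddAction (Rd d) Ω]

/-- The average `∫ f(x) φ(τ_{-x} ω) dx` of a random variable `φ` over translations. -/
def mollify (f : Rd d → ℂ) (φ : Ω → ℂ) (ω : Ω) : ℂ := ∫ x, f x * φ (-x +ᵥ ω)

theorem norm_mollify_le {f : Rd d → ℂ} (hf : Integrable f) {φ : Ω → ℂ}
    {C : ℝ} (hC : ∀ ω, ‖φ ω‖ ≤ C) (ω : Ω) :
    ‖mollify f φ ω‖ ≤ C * ∫ x, ‖f x‖ := by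
  rw [← integral_const_mul]
  refine norm_integral_le_of_norm_le (hf.norm.const_mul C) (Eventually.of_forall fun x => ?_)
  rw [norm_mul, mul_comm]
  exact mul_le_mul_of_nonneg_right (hC _) (norm_nonneg _)

/-- A change of variables moves the translation from `φ`, which has no regularity, onto the smooth
weight. -/
theorem mollify_neg_vadd (f : Rd d → ℂ) (φ : Ω → ℂ) (y : Rd d) (ω : Ω) :
    mollify f φ (-y +ᵥ ω) = mollify (fun x => f (x - y)) φ ω := by
  unfold mollify
  rw [← integral_sub_right_eq_self (fun x => f x * φ (-x +ᵥ (-y +ᵥ ω))) y]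
  refine integral_congr_ae (Eventually.of_forall fun x => ?_)
  simp only [vadd_vadd]
  congr 3
  abel

variable [MeasurableSpace Ω] [MeasurableVAdd₂ (Rd d) Ω]

theorem measurable_comp_neg_vadd {φ : Ω → ℂ} (hφ : Measurable φ) :
    Measurable fun p : Rd d × Ω => φ (-p.1 +ᵥ p.2) :=
  hφ.comp (measurable_fst.neg.vadd measurable_snd)

theorem integrable_mul_comp_neg_vadd {f : Rd d → ℂ} (hf : Integrable f) {φ : Ω → ℂ}
    (hφ : Measurable φ) {C : ℝ} (hC : ∀ ω, ‖φ ω‖ ≤ C) (ω : Ω) :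
    Integrable fun x => f x * φ (-x +ᵥ ω) :=
  hf.mul_bdd (c := C) ((measurable_comp_neg_vadd hφ).comp measurable_prodMk_right).aestronglyMeasurable
    (Eventually.of_forall fun _ => hC _)

theorem stronglyMeasurable_mollify {f : Rd d → ℂ} (hf : Measurable f) {φ : Ω → ℂ}
    (hφ : Measurable φ) : StronglyMeasurable (mollify f φ) :=
  StronglyMeasurable.integral_prod_left' (f := fun p : Rd d × Ω => f p.1 * φ (-p.1 +ᵥ p.2))
    ((hf.comp measurable_fst).mul (measurable_comp_neg_vadd hφ)).stronglyMeasurable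

variable (P : Measure Ω)

theorem coeFn_translation [VAddInvariantMeasure (Rd d) Ω P] (x : Rd d) (u : Lp ℂ 2 P) :
    translation P x u =ᵐ[P] fun ω => u (-x +ᵥ ω) :=
  Lp.coeFn_compMeasurePreserving u (measurePreserving_vadd (-x) P)

variable [IsProbabilityMeasure P]

theorem memLp_mollify {f : Rd d → ℂ} (hf : Integrable f) (hfm : Measurable f) {φ : Ω → ℂ}
    (hφ : Measurable φ) {C : ℝ} (hC : ∀ ω, ‖φ ω‖ ≤ C) (p : ℝ≥0∞) : MemLp (mollify f φ) p P :=
  .of_bound (stronglyMeasurable_mollify hfm hφ).aestronglyMeasurable _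
    (Eventually.of_forall (norm_mollify_le hf hC))

theorem memLp_mollify_schwartz (f : 𝓢(Rd d, ℂ)) {φ : Ω → ℂ}
    (hφ : Measurable φ) {C : ℝ} (hC : ∀ ω, ‖φ ω‖ ≤ C) (p : ℝ≥0∞) : MemLp (mollify f φ) p P :=
  memLp_mollify P f.integrable f.continuous.measurable hφ hC p

/-- The average of a bounded random variable over translations, with a Schwartz weight, as an
element of `L²(Ω)`. -/
def mollifyLp {φ : Ω → ℂ} (hφ : Measurable φ) {C : ℝ} (hC : ∀ ω, ‖φ ω‖ ≤ C) :
    𝓢(Rd d, ℂ) →ₗ[ℂ] Lp ℂ 2 P where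
  toFun f := (memLp_mollify_schwartz P f hφ hC 2).toLp _
  map_add' f g := by
    rw [← MemLp.toLp_add]
    congr 1
    funext ω
    simp only [mollify, add_apply, add_mul, Pi.add_apply]
    exact integral_add (integrable_mul_comp_neg_vadd f.integrable hφ hC ω)
      (integrable_mul_comp_neg_vadd g.integrable hφ hC ω)
  map_smul' c f := by
    rw [RingHom.id_apply, ← MemLp.toLp_const_smul]
    congr 1
    funext ω
    simp only [mollify, smul_apply, smul_eq_mul, mul_assoc, Pi.smul_apply]
    exact integral_const_mul _ _

variable {P} {φ : Ω → ℂ} (hφ : Measurable φ) {C : ℝ} (hC : ∀ ω, ‖φ ω‖ ≤ C)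

theorem coeFn_mollifyLp (f : 𝓢(Rd d, ℂ)) : mollifyLp P hφ hC f =ᵐ[P] mollify f φ :=
  MemLp.coeFn_toLp (memLp_mollify_schwartz P f hφ hC 2)

variable [VAddInvariantMeasure (Rd d) Ω P]

theorem coeFn_translation_mollifyLp (x : Rd d) (f : 𝓢(Rd d, ℂ)) :
    translation P x (mollifyLp P hφ hC f) =ᵐ[P] mollify (fun y => f (y - x)) φ := by
  filter_upwards [coeFn_translation P x (mollifyLp P hφ hC f),
    (measurePreserving_vadd (-x) P).quasiMeasurePreserving.ae (coeFn_mollifyLp hφ hC f)]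
    with ω h1 h2
  rw [h1, h2, mollify_neg_vadd]

/-- With the translation moved onto `f`, the error in the difference quotient is the average of `φ`
against an error that tends to `0` in `L¹`. As `φ` is bounded, it is uniformly small in `ω`. -/
theorem hasDerivAt_orbit_mollifyLp (i : Fin d) (f : 𝓢(Rd d, ℂ)) :
    HasDerivAt (orbit P i (mollifyLp P hφ hC f))
      (mollifyLp P hφ hC (-∂_{EuclideanSpace.single i (1 : ℝ)} f)) 0 := by
  set v : Rd d := EuclideanSpace.single i (1 : ℝ)
  have hC0 : 0 ≤ C := by
    have := (inferInstance : IsProbabilityMeasure P).neZero.out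
    obtain ⟨ω⟩ : Nonempty Ω := by
      by_contra h
      rw [not_nonempty_iff] at h
      exact this (Measure.eq_zero_of_isEmpty P)
    exact (norm_nonneg _).trans (hC ω)
  rw [hasDerivAt_iff_tendsto_slope_zero, tendsto_iff_norm_sub_tendsto_zero]
  have hlim := (tendsto_integral_norm_slope_translate (volume : Measure (Rd d)) f v).const_mul C
  rw [mul_zero] at hlim
  refine squeeze_zero (fun _ => norm_nonneg _) (fun h => ?_) hlim
  have hint : Integrable fun x : Rd d => f (x - h • v) := f.integrable.comp_sub_right (h • v)
  have hw : (EuclideanSpace.single i h : Rd d) = h • v := by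
    ext j; simp [v]
  have h0 : orbit P i (mollifyLp P hφ hC f) 0 = mollifyLp P hφ hC f := by
    apply Lp.ext
    filter_upwards [coeFn_translation P (EuclideanSpace.single i (0 : ℝ)) (mollifyLp P hφ hC f)]
      with ω h1
    rw [orbit, h1, show (EuclideanSpace.single i (0 : ℝ) : Rd d) = 0 by ext; simp, neg_zero,
      zero_vadd]
  rw [zero_add, h0]
  have key : ((h⁻¹ • (orbit P i (mollifyLp P hφ hC f) h - mollifyLp P hφ hC f)
      - mollifyLp P hφ hC (-∂_{v} f) : Lp ℂ 2 P) : Ω → ℂ) =ᵐ[P]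
      mollify (fun x => h⁻¹ • (f (x - h • v) - f x) + (∂_{v} f) x) φ := by
    filter_upwards [Lp.coeFn_sub (h⁻¹ • (orbit P i (mollifyLp P hφ hC f) h - mollifyLp P hφ hC f))
        (mollifyLp P hφ hC (-∂_{v} f)),
      Lp.coeFn_smul h⁻¹ (orbit P i (mollifyLp P hφ hC f) h - mollifyLp P hφ hC f),
      Lp.coeFn_sub (orbit P i (mollifyLp P hφ hC f) h) (mollifyLp P hφ hC f),
      coeFn_mollifyLp hφ hC f, coeFn_mollifyLp hφ hC (-∂_{v} f),
      coeFn_translation_mollifyLp hφ hC (h • v) f] with ω h1 h2 h3 h4 h5 h6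
    rw [h1, Pi.sub_apply, h2, Pi.smul_apply, h3, Pi.sub_apply, orbit, hw, h6, h4, h5]
    have i1 := integrable_mul_comp_neg_vadd hint hφ hC ω
    have i2 := integrable_mul_comp_neg_vadd f.integrable hφ hC ω
    have i3 := integrable_mul_comp_neg_vadd (∂_{v} f).integrable hφ hC ω
    unfold mollify
    rw [← integral_sub i1 i2, ← integral_smul, ← integral_sub]
    · refine integral_congr_ae (Eventually.of_forall fun x => ?_)
      simp only [neg_apply, Complex.real_smul]
      ring
    · exact (i1.sub i2).smul _
    · simpa using i3.neg
  -- On a probability space the uniform bound controls the `L²` norm with constant `1`.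
  have hle := Lp.norm_le_of_ae_bound
    (f := h⁻¹ • (orbit P i (mollifyLp P hφ hC f) h - mollifyLp P hφ hC f)
      - mollifyLp P hφ hC (-∂_{v} f))
    (C := C * ∫ x, ‖h⁻¹ • (f (x - h • v) - f x) + (∂_{v} f) x‖)
    (mul_nonneg hC0 (integral_nonneg fun _ => norm_nonneg _)) (by
      filter_upwards [key] with ω hω
      rw [hω]
      exact norm_mollify_le (((hint.sub f.integrable).smul h⁻¹).add (∂_{v} f).integrable) hC ω)
  simpa [measureUnivNNReal] using hle

end Mollify

/-! ### Averages as test functions for the fibered operator -/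

section TestFunctions

variable {d : ℕ} {Ω : Type*} [MeasurableSpace Ω] [AddAction (Rd d) Ω] [MeasurableVAdd₂ (Rd d) Ω]
  {P : Measure Ω} [IsProbabilityMeasure P]
  {φ : Ω → ℂ} (hφ : Measurable φ) {C : ℝ} (hC : ∀ ω, ‖φ ω‖ ≤ C)

/-- The operator `-Δ + 2 i k · ∇` on Schwartz functions, to which `H_{k,0}^st` corresponds
under averaging over translations. -/
def schwartzLaplacian (k : Rd d) (f : 𝓢(Rd d, ℂ)) : 𝓢(Rd d, ℂ) :=
  -(∑ i : Fin d, ∂_{EuclideanSpace.single i (1 : ℝ)} (∂_{EuclideanSpace.single i (1 : ℝ)} f))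
    + (2 * Complex.I) • ∑ i : Fin d, (k i : ℂ) • ∂_{EuclideanSpace.single i (1 : ℝ)} f

theorem mollifyLp_mem_LInfty (f : 𝓢(Rd d, ℂ)) : mollifyLp P hφ hC f ∈ LInfty P :=
  (memLp_congr_ae (coeFn_mollifyLp hφ hC f)).2 (memLp_mollify_schwartz P f hφ hC ∞)

/-- A bounded random variable as an element of `L²(Ω)`. -/
def boundedLp {Ω : Type*} [MeasurableSpace Ω] {P : Measure Ω} [IsProbabilityMeasure P]
    {φ : Ω → ℂ} (hφ : Measurable φ) {C : ℝ} (hC : ∀ ω, ‖φ ω‖ ≤ C) : Lp ℂ 2 P :=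
  (MemLp.of_bound hφ.aestronglyMeasurable C (Eventually.of_forall hC)).toLp φ

theorem integrable_coeFn_Lp {Ω : Type*} [MeasurableSpace Ω] {P : Measure Ω}
    [IsProbabilityMeasure P] (u : Lp ℂ 2 P) : Integrable u P :=
  (Lp.memLp u).integrable (by norm_num)

theorem integrable_prod_conj_mul {φ : Ω → ℂ} (hφ : Measurable φ) {C : ℝ} (hC : ∀ ω, ‖φ ω‖ ≤ C)
    {f : Rd d → ℂ} (hf : Integrable f) (u : Lp ℂ 2 P) :
    Integrable (fun p : Rd d × Ω => conj (f p.1) * (u p.2 * conj (φ (-p.1 +ᵥ p.2))))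
      (volume.prod P) := by
  have h1 : Integrable (fun p : Rd d × Ω => conj (f p.1) * u p.2) (volume.prod P) :=
    Integrable.mul_prod (Complex.conjLIE.toContinuousLinearEquiv.integrable_comp_iff.2 hf)
      (integrable_coeFn_Lp u)
  refine (h1.mul_bdd (c := C) (g := fun p : Rd d × Ω => conj (φ (-p.1 +ᵥ p.2)))
    (Complex.continuous_conj.measurable.comp (measurable_comp_neg_vadd hφ)).aestronglyMeasurable
    (Eventually.of_forall fun p => ?_)).congr (Eventually.of_forall fun p => by ring)
  simpa using hC _

variable [VAddInvariantMeasure (Rd d) Ω P]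

theorem stPartial_mollifyLp (i : Fin d) (f : 𝓢(Rd d, ℂ)) :
    stPartial P i (mollifyLp P hφ hC f)
      = mollifyLp P hφ hC (-∂_{EuclideanSpace.single i (1 : ℝ)} f) :=
  (hasDerivAt_orbit_mollifyLp hφ hC i f).deriv

theorem mollifyLp_mem_H1 (f : 𝓢(Rd d, ℂ)) : mollifyLp P hφ hC f ∈ H1 (d := d) P :=
  (Submodule.mem_iInf _).2 fun i => (hasDerivAt_orbit_mollifyLp hφ hC i f).differentiableAt

theorem mollifyLp_mem_H2 (f : 𝓢(Rd d, ℂ)) : mollifyLp P hφ hC f ∈ H2 (d := d) P :=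
  ⟨mollifyLp_mem_H1 hφ hC f, fun i => by
    rw [stPartial_mollifyLp]
    exact mollifyLp_mem_H1 hφ hC _⟩

/-- Each stationary derivative becomes `-∂_i` on the weight. The two signs cancel in the
second-order term, and the first-order term changes sign, as in `schwartzLaplacian`. -/
theorem fiberedLaplacian_mollifyLp (k : Rd d) (f : 𝓢(Rd d, ℂ)) :
    fiberedLaplacian P k ⟨mollifyLp P hφ hC f, mollifyLp_mem_H2 hφ hC f⟩
      = mollifyLp P hφ hC (schwartzLaplacian k f) := by
  change -(∑ i : Fin d, stPartial P i (stPartial P i (mollifyLp P hφ hC f)))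
      - (2 * Complex.I) • ∑ i : Fin d, (k i : ℂ) • stPartial P i (mollifyLp P hφ hC f) = _
  simp only [stPartial_mollifyLp, map_neg, stPartial_mollifyLp, schwartzLaplacian, map_add,
    map_sum, map_smul]
  have h : ∀ i : Fin d, stPartial P i
      (-mollifyLp P hφ hC (∂_{EuclideanSpace.single i (1 : ℝ)} f))
      = mollifyLp P hφ hC
        (∂_{EuclideanSpace.single i (1 : ℝ)} (∂_{EuclideanSpace.single i (1 : ℝ)} f)) := by
    intro i
    have h1 := stPartial_smul P i (-1) (mem_partialDomain_of_mem_H1 P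
      (mollifyLp_mem_H1 hφ hC (∂_{EuclideanSpace.single i (1 : ℝ)} f)) i)
    rw [neg_one_smul, neg_one_smul, stPartial_mollifyLp, map_neg, neg_neg] at h1
    exact h1
  simp only [h, smul_neg, Finset.sum_neg_distrib, sub_neg_eq_add]

theorem inner_translation_boundedLp (x : Rd d) (u : Lp ℂ 2 P) :
    inner ℂ (translation P x (boundedLp hφ hC)) u = ∫ ω, u ω * conj (φ (-x +ᵥ ω)) ∂P := by
  rw [L2.inner_def]
  refine integral_congr_ae ?_
  filter_upwards [coeFn_translation P x (boundedLp hφ hC),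
    (measurePreserving_vadd (-x) P).quasiMeasurePreserving.ae
      (MemLp.coeFn_toLp (MemLp.of_bound hφ.aestronglyMeasurable C (Eventually.of_forall hC)
        : MemLp φ 2 P))] with ω h1 h2
  rw [h1, RCLike.inner_apply]
  congr 2

theorem inner_translation_boundedLp' (x : Rd d) (u : Lp ℂ 2 P) :
    inner ℂ (translation P x (boundedLp hφ hC)) u = ∫ ω, u (x +ᵥ ω) * conj (φ ω) ∂P := by
  rw [inner_translation_boundedLp]
  have h := (measurePreserving_vadd x P).integral_comp (measurableEmbedding_const_vadd x)
    (fun ω => u ω * conj (φ (-x +ᵥ ω)))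
  simpa [vadd_vadd] using h.symm

theorem inner_mollifyLp (f : 𝓢(Rd d, ℂ)) (u : Lp ℂ 2 P) :
    inner ℂ (mollifyLp P hφ hC f) u
      = ∫ x, conj (f x) * inner ℂ (translation P x (boundedLp hφ hC)) u := by
  rw [L2.inner_def]
  simp only [inner_translation_boundedLp, ← integral_const_mul]
  rw [integral_integral_swap (integrable_prod_conj_mul hφ hC f.integrable u)]
  refine integral_congr_ae ?_
  filter_upwards [coeFn_mollifyLp hφ hC f] with ω h1
  rw [h1, RCLike.inner_apply, mollify, ← integral_conj, ← integral_const_mul]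
  refine integral_congr_ae (Eventually.of_forall fun x => ?_)
  simp only [map_mul]
  ring

theorem integrable_inner_translation_boundedLp {φ : Ω → ℂ}
    (hφ : Measurable φ) {C : ℝ} (hC : ∀ ω, ‖φ ω‖ ≤ C) {f : Rd d → ℂ} (hf : Integrable f)
    (u : Lp ℂ 2 P) :
    Integrable fun x => conj (f x) * inner ℂ (translation P x (boundedLp hφ hC)) u := by
  simp only [inner_translation_boundedLp, ← integral_const_mul]
  exact (integrable_prod_conj_mul hφ hC hf u).integral_prod_left

end TestFunctions

/-! ### Density of the test functions -/

section Density

variable {d : ℕ} {Ω : Type*} [MeasurableSpace Ω] [AddAction (Rd d) Ω] [MeasurableVAdd₂ (Rd d) Ω]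
  {P : Measure Ω}

/-- A function on a product space is a.e. zero if its integral on every rectangle vanishes. -/
theorem ae_eq_zero_of_setIntegral_prod_eq_zero {X Y : Type*} [MeasurableSpace X]
    [MeasurableSpace Y] {μ : Measure (X × Y)} {F : X × Y → ℂ} (hF : Integrable F μ)
    (h : ∀ s t, MeasurableSet s → MeasurableSet t → ∫ p in s ×ˢ t, F p ∂μ = 0) : F =ᵐ[μ] 0 := by
  suffices ∀ s, MeasurableSet s → ∫ p in s, F p ∂μ = 0 from
    hF.ae_eq_zero_of_forall_setIntegral_eq_zero fun s hs _ => this s hs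
  intro s hs
  induction s, hs using MeasurableSpace.induction_on_inter generateFrom_prod.symm isPiSystem_prod with
  | empty => simp
  | basic t ht =>
    obtain ⟨a, ha, b, hb, rfl⟩ := ht
    exact h a b ha hb
  | compl t htm ih =>
    have h1 := integral_add_compl htm hF
    have h2 := h univ univ .univ .univ
    rw [univ_prod_univ, setIntegral_univ] at h2
    rwa [ih, zero_add, h2] at h1
  | iUnion f hd hfm ih =>
    rw [integral_iUnion hfm hd hF.integrableOn]
    simp [ih]

theorem measurable_vadd_Lp (u : Lp ℂ 2 P) : Measurable fun p : Rd d × Ω => u (p.1 +ᵥ p.2) :=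
  (Lp.stronglyMeasurable u).measurable.comp (measurable_fst.vadd measurable_snd)

variable [VAddInvariantMeasure (Rd d) Ω P]

theorem integral_norm_vadd_Lp (u : Lp ℂ 2 P) (x : Rd d) :
    ∫ ω, ‖u (x +ᵥ ω)‖ ∂P = ∫ ω, ‖u ω‖ ∂P :=
  (measurePreserving_vadd x P).integral_comp (measurableEmbedding_const_vadd x) (fun ω => ‖u ω‖)

variable [IsProbabilityMeasure P]

theorem integrable_vadd_Lp (u : Lp ℂ 2 P) (x : Rd d) : Integrable (fun ω => u (x +ᵥ ω)) P :=
  (measurePreserving_vadd x P).integrable_comp_of_integrable (integrable_coeFn_Lp u)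

/-- `H²(Ω) ∩ L^∞(Ω)` is dense in `L²(Ω)`. -/
theorem dense_H2_inf_LInfty : Dense ((H2 (d := d) P ⊓ LInfty P : Submodule ℂ (Lp ℂ 2 P)) :
    Set (Lp ℂ 2 P)) := by
  rw [Submodule.dense_iff_topologicalClosure_eq_top, Submodule.topologicalClosure_eq_top_iff,
    Submodule.eq_bot_iff]
  intro u hu
  rw [Submodule.mem_orthogonal] at hu
  -- Orthogonality to averages of the indicator of `B` with arbitrary smooth compactly supported
  -- weights. The null set of `x` depends on `B`, so no single `x` can be chosen yet; the product
  -- space is used below to remove this dependence.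
  have hset : ∀ B : Set Ω, MeasurableSet B → ∀ᵐ x : Rd d, ∫ ω in B, u (x +ᵥ ω) ∂P = 0 := by
    intro B hB
    have hφ : Measurable (B.indicator fun _ => (1 : ℂ)) := measurable_const.indicator hB
    have hC : ∀ ω, ‖B.indicator (fun _ => (1 : ℂ)) ω‖ ≤ 1 := fun ω => by
      refine (norm_indicator_le_norm_self _ _).trans ?_
      simp
    have hinner : ∀ x : Rd d, inner ℂ (translation P x (boundedLp hφ hC)) u
        = ∫ ω in B, u (x +ᵥ ω) ∂P := by
      intro x
      rw [inner_translation_boundedLp', ← integral_indicator hB]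
      refine integral_congr_ae (Eventually.of_forall fun ω => ?_)
      by_cases hω : ω ∈ B <;> simp [hω]
    refine ae_eq_zero_of_integral_contDiff_smul_eq_zero ?_ fun g hg hgs => ?_
    · have hm : AEStronglyMeasurable (fun x : Rd d => ∫ ω in B, u (x +ᵥ ω) ∂P) volume :=
        (StronglyMeasurable.integral_prod_right' (f := fun p : Rd d × Ω => u (p.1 +ᵥ p.2))
          (measurable_vadd_Lp u).stronglyMeasurable).aestronglyMeasurable
      refine (locallyIntegrable_const (∫ ω, ‖u ω‖ ∂P)).mono hm (Eventually.of_forall fun x => ?_)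
      rw [Real.norm_of_nonneg (integral_nonneg fun _ => norm_nonneg _),
        ← integral_norm_vadd_Lp u x]
      exact (norm_integral_le_integral_norm _).trans (setIntegral_le_integral
        (integrable_vadd_Lp u x).norm (Eventually.of_forall fun _ => norm_nonneg _))
    · have hgc : HasCompactSupport fun x => (g x : ℂ) := hgs.comp_left Complex.ofReal_zero
      have hgd : ContDiff ℝ (⊤ : ℕ∞) fun x => (g x : ℂ) := Complex.ofRealCLM.contDiff.comp hg
      have h := hu _ (Submodule.mem_inf.2 ⟨mollifyLp_mem_H2 hφ hC (hgc.toSchwartzMap hgd),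
        mollifyLp_mem_LInfty hφ hC (hgc.toSchwartzMap hgd)⟩)
      rw [inner_mollifyLp] at h
      simp only [hinner] at h
      simpa using h
  -- Restricting `x` to a ball makes the measure finite, so that `u (x +ᵥ ω)` is jointly integrable.
  set μ : Measure (Rd d) := volume.restrict (Metric.ball 0 1) with hμ
  have : IsFiniteMeasure μ := ⟨by simpa [hμ] using measure_ball_lt_top⟩
  have hF : Integrable (fun p : Rd d × Ω => u (p.1 +ᵥ p.2)) (μ.prod P) := by
    rw [integrable_prod_iff (measurable_vadd_Lp u).aestronglyMeasurable]
    refine ⟨Eventually.of_forall (integrable_vadd_Lp u), ?_⟩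
    simp only [integral_norm_vadd_Lp]
    exact integrable_const _
  have hzero := ae_eq_zero_of_setIntegral_prod_eq_zero hF fun s t _ ht => by
    rw [setIntegral_prod _ hF.integrableOn]
    refine integral_eq_zero_of_ae ?_
    exact ae_restrict_of_ae (ae_restrict_of_ae (hset t ht))
  have hne : (ae μ).NeBot := by
    rw [ae_neBot, hμ, Ne, Measure.restrict_eq_zero]
    exact (Metric.measure_ball_pos volume 0 one_pos).ne'
  -- One `x` suffices: translating back by `-x`, which preserves `P`, gives `u = 0`.
  obtain ⟨x, hx⟩ := (Measure.ae_ae_of_ae_prod hzero).exists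
  rw [Lp.eq_zero_iff_ae_eq_zero]
  filter_upwards [(measurePreserving_vadd (-x) P).quasiMeasurePreserving.ae hx] with ω hω
  simpa [vadd_vadd] using hω

end Density

/-! ### The first-order perturbation equation -/

section FirstOrder

variable {d : ℕ} {Ω : Type*} [MeasurableSpace Ω]
  {P : Measure Ω}

/-- A real random variable `V ∈ L²(Ω)` as an element of the complex space `L²(Ω)`. -/
def potentialLp {V : Ω → ℝ} (hV : MemLp V 2 P) : Lp ℂ 2 P :=
  (hV.ofReal : MemLp (fun ω => (V ω : ℂ)) 2 P).toLp _

theorem coeFn_potentialLp {V : Ω → ℝ} (hV : MemLp V 2 P) :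
    potentialLp hV =ᵐ[P] fun ω => (V ω : ℂ) := MemLp.coeFn_toLp _

/-- Since `V` is real, it moves to the other factor; this identifies the first-order effect of `λ V`
on the state `1`. -/
theorem inner_mulPotential_const [IsProbabilityMeasure P] {V : Ω → ℝ} (hV : MemLp V 2 P)
    (φ : LInfty P) :
    inner ℂ (mulPotential hV φ) (Lp.const 2 P (1 : ℂ)) = inner ℂ (φ : Lp ℂ 2 P) (potentialLp hV) := by
  rw [L2.inner_def, L2.inner_def]
  refine integral_congr_ae ?_
  filter_upwards [(memLp_mul_of_mem_LInfty hV φ).coeFn_toLp, Lp.coeFn_const 2 P (1 : ℂ),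
    coeFn_potentialLp hV] with ω h1 h2 h3
  rw [mulPotential, LinearMap.coe_mk, AddHom.coe_mk, h1, h2, h3]
  simp [RCLike.inner_apply]

theorem inner_const_potentialLp [IsProbabilityMeasure P] {V : Ω → ℝ} (hV : MemLp V 2 P)
    (hV0 : ∫ ω, V ω ∂P = 0) : inner ℂ (Lp.const 2 P (1 : ℂ)) (potentialLp hV) = 0 := by
  rw [L2.inner_def]
  calc _ = ∫ ω, (V ω : ℂ) ∂P := by
        refine integral_congr_ae ?_
        filter_upwards [Lp.coeFn_const 2 P (1 : ℂ), coeFn_potentialLp hV] with ω h2 h3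
        rw [h2, h3]
        simp [RCLike.inner_apply]
    _ = 0 := by rw [integral_complex_ofReal, hV0, Complex.ofReal_zero]

variable [AddAction (Rd d) Ω] [MeasurableVAdd₂ (Rd d) Ω]
  [IsProbabilityMeasure P] [VAddInvariantMeasure (Rd d) Ω P]

theorem translation_const (x : Rd d) (c : ℂ) :
    translation P x (Lp.const 2 P c) = Lp.const 2 P c := by
  apply Lp.ext
  filter_upwards [coeFn_translation P x (Lp.const 2 P c), Lp.coeFn_const 2 P c,
    (measurePreserving_vadd (-x) P).quasiMeasurePreserving.ae (Lp.coeFn_const 2 P c)]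
    with ω h1 h2 h3
  rw [h1, h2, h3]
  rfl

theorem orbit_const (i : Fin d) (c : ℂ) :
    orbit P i (Lp.const 2 P c) = fun _ => Lp.const 2 P c := by
  funext h; exact translation_const _ c

theorem stPartial_const (i : Fin d) (c : ℂ) : stPartial P i (Lp.const 2 P c) = 0 := by
  rw [stPartial, orbit_const, deriv_const]

theorem const_mem_H2 (c : ℂ) : Lp.const 2 P c ∈ H2 (d := d) P := by
  refine ⟨(Submodule.mem_iInf _).2 fun i => ?_, fun i => ?_⟩
  · change DifferentiableAt ℝ (orbit P i (Lp.const 2 P c)) 0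
    rw [orbit_const]
    exact differentiableAt_const _
  · rw [stPartial_const]
    exact Submodule.zero_mem _

theorem const_mem_LInfty {Ω : Type*} [MeasurableSpace Ω] {P : Measure Ω} [IsProbabilityMeasure P]
    (c : ℂ) : Lp.const 2 P c ∈ LInfty P :=
  (memLp_congr_ae (Lp.coeFn_const 2 P c)).2 (memLp_const c)

theorem fiberedLaplacian_const (k : Rd d) (c : ℂ) :
    fiberedLaplacian P k ⟨Lp.const 2 P c, const_mem_H2 c⟩ = 0 := by
  change -(∑ i : Fin d, stPartial P i (stPartial P i (Lp.const 2 P c)))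
      - (2 * Complex.I) • ∑ i : Fin d, (k i : ℂ) • stPartial P i (Lp.const 2 P c) = _
  have h : ∀ i : Fin d, stPartial P i (0 : Lp ℂ 2 P) = 0 := fun i => by
    rw [← map_zero (Lp.const 2 P), stPartial_const]
    rfl
  simp [stPartial_const, h]

/-- The weak form of the eigenvalue equation. -/
theorem inner_eigenvalue_eq {V : Ω → ℝ} (hV : MemLp V 2 P) (k : Rd d) {lam E : ℝ} {ψ : Lp ℂ 2 P}
    (h : ∃ h : ψ ∈ (fiberedSchrodinger P hV k lam).domain,
      fiberedSchrodinger P hV k lam ⟨ψ, h⟩ = (E : ℂ) • ψ)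
    {φ : Lp ℂ 2 P} (h2 : φ ∈ H2 (d := d) P) (hi : φ ∈ LInfty P) :
    inner ℂ (fiberedLaplacian P k ⟨φ, h2⟩) ψ + lam • inner ℂ (mulPotential hV ⟨φ, hi⟩) ψ
      = E • inner ℂ φ ψ := by
  obtain ⟨hψ, hEψ⟩ := h
  -- Density is essential here: on a non-dense domain `LinearPMap.adjoint` takes a default value.
  have h3 := (LinearPMap.adjoint_isFormalAdjoint (T := fiberedMinimal P hV k lam)
    dense_H2_inf_LInfty).symm ⟨φ, h2, hi⟩ ⟨ψ, hψ⟩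
  have h4 : fiberedMinimal P hV k lam ⟨φ, h2, hi⟩
      = fiberedLaplacian P k ⟨φ, h2⟩ + (lam : ℂ) • mulPotential hV ⟨φ, hi⟩ := rfl
  have h5 : (fiberedMinimal P hV k lam).adjoint ⟨ψ, hψ⟩ = (E : ℂ) • ψ := hEψ
  rw [h4, h5, inner_add_left, inner_smul_left, inner_smul_right] at h3
  simpa using h3

/-- The first-order equation: the derivative at `0` of a differentiable branch of bound states
solves `H_{k,0}^st ψ' = -V` weakly. -/
theorem exists_weak_corrector {V : Ω → ℝ} (hV : MemLp V 2 P) (hV0 : ∫ ω, V ω ∂P = 0) (k : Rd d)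
    {δ : ℝ} {E : ℝ → ℝ} {ψ : ℝ → Lp ℂ 2 P} (hδ : 0 < δ)
    (hd : DifferentiableWithinAt ℝ (fun lam => (E lam, ψ lam)) (Ico 0 δ) 0)
    (heq : ∀ lam ∈ Ico 0 δ, ∃ h : ψ lam ∈ (fiberedSchrodinger P hV k lam).domain,
      fiberedSchrodinger P hV k lam ⟨ψ lam, h⟩ = (E lam : ℂ) • ψ lam)
    (hE0 : E 0 = 0) (hψ0 : ψ 0 = Lp.const 2 P (1 : ℂ)) :
    ∃ ψ' : Lp ℂ 2 P, ∀ (φ : Lp ℂ 2 P) (h2 : φ ∈ H2 (d := d) P), φ ∈ LInfty P →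
      inner ℂ (fiberedLaplacian P k ⟨φ, h2⟩) ψ' = -inner ℂ φ (potentialLp hV) := by
  have hEd : HasDerivWithinAt E (derivWithin E (Ico 0 δ) 0) (Ico 0 δ) 0 :=
    (hd.fst).hasDerivWithinAt
  have hψd : HasDerivWithinAt ψ (derivWithin ψ (Ico 0 δ) 0) (Ico 0 δ) 0 :=
    (hd.snd).hasDerivWithinAt
  set E' := derivWithin E (Ico 0 δ) 0
  set ψ' := derivWithin ψ (Ico 0 δ) 0
  have h0 : (0 : ℝ) ∈ Ico 0 δ := ⟨le_rfl, hδ⟩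
  have key : ∀ (φ : Lp ℂ 2 P) (h2 : φ ∈ H2 (d := d) P) (hi : φ ∈ LInfty P),
      inner ℂ (fiberedLaplacian P k ⟨φ, h2⟩) ψ' + inner ℂ φ (potentialLp hV)
        = E' • inner ℂ φ (Lp.const 2 P (1 : ℂ)) := by
    intro φ h2 hi
    have hin : ∀ v : Lp ℂ 2 P, HasDerivWithinAt (fun lam => inner ℂ v (ψ lam)) (inner ℂ v ψ')
        (Ico 0 δ) 0 := fun v =>
      ((innerSL ℂ v).restrictScalars ℝ).hasFDerivAt.comp_hasDerivWithinAt 0 hψd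
    have hl := (hin (fiberedLaplacian P k ⟨φ, h2⟩)).add
      ((hasDerivWithinAt_id 0 (Ico 0 δ)).smul (hin (mulPotential hV ⟨φ, hi⟩)))
    have hr := hEd.smul (hin φ)
    -- Both sides of the weak equation have a right derivative at `0`. In the product rule, `λ` and
    -- `E` vanish at `0`, so `ψ'` survives only in the Laplacian term.
    have hu := ((uniqueDiffOn_Ico 0 δ) 0 h0).eq_deriv _
      (hl.congr_of_mem (f₁ := fun lam => E lam • inner ℂ φ (ψ lam))
        (fun lam hlam => (inner_eigenvalue_eq hV k (heq lam hlam) h2 hi).symm) h0) hr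
    simp only [hE0, hψ0, id, zero_smul, zero_add, one_smul, inner_mulPotential_const] at hu
    exact hu
  -- The constant `1` is in the kernel of the Laplacian and orthogonal to `V`, so testing with it
  -- isolates `E'`.
  have h1 := key _ (const_mem_H2 1) (const_mem_LInfty 1)
  have hE' : E' = 0 := by
    rw [fiberedLaplacian_const, inner_zero_left, inner_const_potentialLp hV hV0, add_zero] at h1
    have hne : inner ℂ (Lp.const 2 P (1 : ℂ)) (Lp.const 2 P (1 : ℂ)) ≠ 0 := by
      rw [inner_self_ne_zero, ← norm_ne_zero_iff, Lp.norm_const]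
      · simp
      · norm_num
    exact (smul_eq_zero.1 h1.symm).resolve_right hne
  refine ⟨ψ', fun φ h2 hi => ?_⟩
  rw [eq_neg_iff_add_eq_zero, key φ h2 hi, hE', zero_smul]

end FirstOrder

/-! ### Spectral calculus along a stationary orbit -/

section SpectralMeasure

variable {d : ℕ}

/-- The transform `z ↦ ∫ F(y) e^{i z · y} dy`. -/
def charTransform (F : Rd d → ℂ) (z : Rd d) : ℂ :=
  ∫ y, F y * Complex.exp (inner ℝ z y * Complex.I)

theorem norm_exp_inner_mul_I (z y : Rd d) : ‖Complex.exp (inner ℝ z y * Complex.I)‖ = 1 :=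
  Complex.norm_exp_ofReal_mul_I _

theorem continuous_charTransform {F : Rd d → ℂ} (hF : Integrable F) :
    Continuous (charTransform F) := by
  refine continuous_of_dominated (bound := fun y => ‖F y‖) (fun z => ?_) (fun z => ?_) hF.norm ?_
  · exact hF.aestronglyMeasurable.mul (Continuous.aestronglyMeasurable (by fun_prop))
  · exact Eventually.of_forall fun y => by rw [norm_mul, norm_exp_inner_mul_I, mul_one]
  · exact Eventually.of_forall fun y => by fun_prop

theorem norm_charTransform_le (F : Rd d → ℂ) (z : Rd d) :
    ‖charTransform F z‖ ≤ ∫ y, ‖F y‖ := by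
  refine (norm_integral_le_integral_norm _).trans (le_of_eq ?_)
  simp only [norm_mul, norm_exp_inner_mul_I, mul_one]

variable {ν : Measure (Rd d)} [IsFiniteMeasure ν]

theorem integrable_charTransform {F : Rd d → ℂ} (hF : Integrable F) :
    Integrable (charTransform F) ν :=
  .of_bound (continuous_charTransform hF).aestronglyMeasurable _
    (Eventually.of_forall (norm_charTransform_le F))

theorem integral_mul_integral_exp {F h : Rd d → ℂ} (hF : Integrable F) (hh : Integrable h ν) :
    ∫ y, F y * ∫ z, Complex.exp (inner ℝ z y * Complex.I) * h z ∂ν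
      = ∫ z, charTransform F z * h z ∂ν := by
  simp only [← integral_const_mul, charTransform, ← integral_mul_const]
  rw [integral_integral_swap]
  · simp only [mul_assoc]
  · refine ((hF.mul_prod hh).mul_bdd (c := 1)
      (g := fun p : Rd d × Rd d => Complex.exp (inner ℝ p.2 p.1 * Complex.I))
      (Continuous.aestronglyMeasurable (by fun_prop))
      (Eventually.of_forall fun p => (norm_exp_inner_mul_I _ _).le)).congr
      (Eventually.of_forall fun p => ?_)
    simp only [Function.uncurry]
    ring

variable {H : Type*} [NormedAddCommGroup H] [InnerProductSpace ℂ H]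

/-- A curve in a Hilbert space with stationary covariance `c ν̂` is continuous. -/
theorem continuous_of_inner_eq_charFun {v : Rd d → H} {c : ℝ}
    (hv : ∀ x y, inner ℂ (v x) (v y) = c * charFun ν (y - x)) : Continuous v := by
  rw [continuous_iff_continuousAt]
  intro a
  have hcf : Continuous (charFun ν) := continuous_charFun
  have h : ∀ x, ‖v x - v a‖ ^ 2 = (2 * (c * charFun ν 0)).re - 2 * (c * charFun ν (a - x)).re := by
    intro x
    rw [@norm_sub_sq ℂ, ← @inner_self_eq_norm_sq ℂ, ← @inner_self_eq_norm_sq ℂ, hv x x,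
      hv a a, hv x a, sub_self, sub_self]
    simp only [RCLike.re_to_complex, two_mul, Complex.add_re]
    ring
  rw [ContinuousAt, tendsto_iff_norm_sub_tendsto_zero]
  have h2 : Tendsto (fun x => ‖v x - v a‖ ^ 2) (𝓝 a) (𝓝 0) := by
    simp only [h]
    have h3 : Continuous fun x => (2 * (c * charFun ν 0)).re - 2 * (c * charFun ν (a - x)).re := by
      fun_prop
    have h4 := h3.tendsto a
    simp only [sub_self] at h4
    simpa using h4
  simpa using h2.sqrt

variable {v : Rd d → H} {c : ℝ}
  (hv : ∀ x y, inner ℂ (v x) (v y) = c * charFun ν (y - x))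
  {F : Rd d → ℂ} (hF : Integrable F)

include hv hF

theorem integrable_smul_of_inner_eq_charFun : Integrable fun x => F x • v x := by
  refine hF.smul_bdd ‖v 0‖ (continuous_of_inner_eq_charFun hv).aestronglyMeasurable
    (Eventually.of_forall fun x => le_of_eq ?_)
  have h : inner ℂ (v x) (v x) = inner ℂ (v 0) (v 0) := by rw [hv, hv, sub_self, sub_self]
  rw [@norm_eq_sqrt_re_inner ℂ, h, ← @norm_eq_sqrt_re_inner ℂ]

variable [CompleteSpace H]

/-- Up to the factor `c`, the covariance identifies `v x` with the character `z ↦ e^{i z · x}` in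
`L²(ν)`, hence `∫ F v` with `charTransform F`. This and `norm_integral_smul_sq_eq` are the parts of
that isometry needed, obtained by Fubini. -/
theorem inner_integral_smul_eq (x : Rd d) :
    inner ℂ (v x) (∫ y, F y • v y)
      = c * ∫ z, charTransform F z * Complex.exp (-(inner ℝ z x * Complex.I)) ∂ν := by
  have hint : Integrable (fun z : Rd d => Complex.exp (-(inner ℝ z x * Complex.I))) ν := by
    refine .of_bound (Continuous.aestronglyMeasurable (by fun_prop)) 1
      (Eventually.of_forall fun z => le_of_eq ?_)
    rw [← neg_mul, ← Complex.ofReal_neg, Complex.norm_exp_ofReal_mul_I]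
  rw [← integral_inner (integrable_smul_of_inner_eq_charFun hv hF),
    ← integral_mul_integral_exp hF hint, ← integral_const_mul]
  refine integral_congr_ae (Eventually.of_forall fun y => ?_)
  simp only [inner_smul_right, hv, charFun_apply]
  rw [mul_left_comm]
  congr 3
  funext z
  rw [← Complex.exp_add, inner_sub_right]
  congr 1
  push_cast
  ring

theorem inner_zero_integral_smul_eq :
    inner ℂ (v 0) (∫ y, F y • v y) = c * ∫ z, charTransform F z ∂ν := by
  rw [inner_integral_smul_eq hv hF]
  simp

theorem norm_integral_smul_sq_eq :
    ‖∫ y, F y • v y‖ ^ 2 = c * ∫ z, ‖charTransform F z‖ ^ 2 ∂ν := by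
  have hconj : Integrable (fun z => conj (charTransform F z)) ν :=
    Complex.conjLIE.toContinuousLinearEquiv.integrable_comp_iff.2 (integrable_charTransform hF)
  have h : inner ℂ (∫ y, F y • v y) (∫ y, F y • v y)
      = c * ∫ z, charTransform F z * conj (charTransform F z) ∂ν := by
    rw [← integral_inner (integrable_smul_of_inner_eq_charFun hv hF),
      ← integral_mul_integral_exp hF hconj, ← integral_const_mul]
    refine integral_congr_ae (Eventually.of_forall fun y => ?_)
    simp only [inner_smul_right]
    rw [← inner_conj_symm, inner_integral_smul_eq hv hF, mul_left_comm, map_mul, ← integral_conj,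
      Complex.conj_ofReal]
    congr 3
    funext z
    rw [map_mul, ← Complex.exp_conj, mul_comm]
    simp
  rw [← @inner_self_eq_norm_sq ℂ, h]
  simp only [Complex.mul_conj, Complex.normSq_eq_norm_sq, integral_complex_ofReal]
  rw [← Complex.ofReal_mul]
  exact Complex.ofReal_re _

end SpectralMeasure

/-! ### The orbit of the potential and extension of the test functions -/

section Covariance

variable {d : ℕ} {Ω : Type*} [MeasurableSpace Ω] [AddAction (Rd d) Ω] [MeasurableVAdd₂ (Rd d) Ω]
  {P : Measure Ω} [VAddInvariantMeasure (Rd d) Ω P]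

theorem inner_translation_potentialLp {V : Ω → ℝ} (hV : MemLp V 2 P) (x y : Rd d) :
    inner ℂ (translation P x (potentialLp hV)) (translation P y (potentialLp hV))
      = (covarianceFunction P V (y - x) : ℂ) := by
  rw [L2.inner_def]
  have h1 : ∫ ω, inner ℂ (translation P x (potentialLp hV) ω) (translation P y (potentialLp hV) ω) ∂P
      = ∫ ω, ((V (-y +ᵥ ω) * V (-x +ᵥ ω) : ℝ) : ℂ) ∂P := by
    refine integral_congr_ae ?_
    filter_upwards [coeFn_translation P x (potentialLp hV), coeFn_translation P y (potentialLp hV),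
      (measurePreserving_vadd (-x) P).quasiMeasurePreserving.ae (coeFn_potentialLp hV),
      (measurePreserving_vadd (-y) P).quasiMeasurePreserving.ae (coeFn_potentialLp hV)]
      with ω h1 h2 h3 h4
    rw [h1, h2, h3, h4]
    simp [RCLike.inner_apply]
  rw [h1, integral_complex_ofReal, covarianceFunction]
  congr 1
  have h := (measurePreserving_vadd (-x) P).integral_comp (measurableEmbedding_const_vadd (-x))
    (fun ω => V (-(y - x) +ᵥ ω) * V ω)
  rw [← h]
  refine integral_congr_ae (Eventually.of_forall fun ω => ?_)
  simp only [vadd_vadd]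
  congr 3
  abel

variable [IsProbabilityMeasure P]

theorem exists_boundedLp_eq_simpleFunc (s : Lp.simpleFunc ℂ 2 P) :
    ∃ (φ : Ω → ℂ) (hφ : Measurable φ) (C : ℝ) (hC : ∀ ω, ‖φ ω‖ ≤ C),
      boundedLp hφ hC = (s : Lp ℂ 2 P) := by
  obtain ⟨C, hC⟩ := (Lp.simpleFunc.toSimpleFunc s).exists_forall_norm_le
  refine ⟨_, (Lp.simpleFunc.toSimpleFunc s).measurable, C, hC, ?_⟩
  apply Lp.ext
  exact (MemLp.coeFn_toLp _).trans (Lp.simpleFunc.toSimpleFunc_eq_toFun s)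

/-- A weak equation tested against averages of bounded random variables extends to averages of any
`w ∈ L²(Ω)` with continuous orbit. -/
theorem inner_integral_smul_translation_eq {f g : 𝓢(Rd d, ℂ)} {u u' : Lp ℂ 2 P}
    (h : ∀ (φ : Ω → ℂ) (hφ : Measurable φ) (C : ℝ) (hC : ∀ ω, ‖φ ω‖ ≤ C),
      inner ℂ (mollifyLp P hφ hC f) u = inner ℂ (mollifyLp P hφ hC g) u')
    {w : Lp ℂ 2 P} (hw : Continuous fun x : Rd d => translation P x w) :
    inner ℂ (∫ x, f x • translation P x w) u = inner ℂ (∫ x, g x • translation P x w) u' := by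
  obtain ⟨s, hs, hsw⟩ := mem_closure_iff_seq_limit.1
    ((Lp.simpleFunc.denseRange (α := Ω) (E := ℂ) (p := 2) (μ := P) (by norm_num)) w)
  have hbdd : ∀ n, ∃ (φ : Ω → ℂ) (hφ : Measurable φ) (C : ℝ) (hC : ∀ ω, ‖φ ω‖ ≤ C),
      boundedLp hφ hC = s n := fun n => by
    obtain ⟨t, ht⟩ := hs n
    rw [← ht]
    exact exists_boundedLp_eq_simpleFunc t
  choose φ hφ C hC hφs using hbdd
  have hinner : ∀ (f : 𝓢(Rd d, ℂ)) (u : Lp ℂ 2 P),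
      inner ℂ (∫ x, f x • translation P x w) u
        = ∫ x, conj (f x) * inner ℂ (translation P x w) u := by
    intro f u
    have hint : Integrable fun x => f x • translation P x w :=
      f.integrable.smul_bdd ‖w‖ hw.aestronglyMeasurable
        (Eventually.of_forall fun x => ((translation P x).norm_map w).le)
    rw [← inner_conj_symm, ← integral_inner hint, ← integral_conj]
    refine integral_congr_ae (Eventually.of_forall fun x => ?_)
    simp only [inner_smul_right, map_mul, inner_conj_symm]
  have hlim : ∀ (f : 𝓢(Rd d, ℂ)) (u : Lp ℂ 2 P),
      Tendsto (fun n => inner ℂ (mollifyLp P (hφ n) (hC n) f) u) atTop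
        (𝓝 (inner ℂ (∫ x, f x • translation P x w) u)) := by
    intro f u
    simp only [hinner, inner_mollifyLp]
    -- Translations are isometries, so `‖s n‖ ≤ ‖w‖ + 1` for large `n` gives a bound uniform in `x`.
    refine tendsto_integral_filter_of_dominated_convergence
      (fun x => ‖f x‖ * ((‖w‖ + 1) * ‖u‖)) ?_ ?_ (f.integrable.norm.mul_const _) ?_
    · exact Eventually.of_forall fun n =>
        (integrable_inner_translation_boundedLp (hφ n) (hC n) f.integrable u).aestronglyMeasurable
    · filter_upwards [hsw.norm.eventually_le_const (lt_add_one ‖w‖)] with n hn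
      refine Eventually.of_forall fun x => ?_
      rw [norm_mul, RCLike.norm_conj, hφs]
      gcongr
      refine (norm_inner_le_norm _ _).trans ?_
      rw [(translation P x).norm_map]
      gcongr
    · refine Eventually.of_forall fun x => Tendsto.const_mul _ ?_
      simp only [hφs]
      exact (((translation P x).continuous.tendsto w).comp hsw).inner tendsto_const_nhds
  refine tendsto_nhds_unique (hlim f u) ?_
  simp only [h]
  exact hlim g u'

end Covariance

/-! ### The symbol and cutoffs near the sphere -/

section Symbol

variable {d : ℕ}

/-- The Fourier symbol `|z + k|² - |k|²` of the fibered Laplacian. -/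
def fiberedSymbol (k z : Rd d) : ℝ := ‖z + k‖ ^ 2 - ‖k‖ ^ 2

theorem charTransform_schwartz_eq (f : 𝓢(Rd d, ℂ)) (z : Rd d) :
    charTransform f z = (𝓕⁻ f) ((2 * Real.pi)⁻¹ • z) := by
  rw [SchwartzMap.fourierInv_coe, Real.fourierInv_eq']
  refine integral_congr_ae (Eventually.of_forall fun y => ?_)
  simp only [smul_eq_mul, inner_smul_right]
  rw [mul_comm, mul_inv_cancel_left₀ (by positivity), real_inner_comm]

theorem charTransform_lineDerivOp (f : 𝓢(Rd d, ℂ)) (i : Fin d) (z : Rd d) :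
    charTransform (∂_{EuclideanSpace.single i (1 : ℝ)} f : 𝓢(Rd d, ℂ)) z
      = -(Complex.I * z i) * charTransform f z := by
  rw [charTransform_schwartz_eq, charTransform_schwartz_eq, SchwartzMap.fourierInv_lineDerivOp_eq,
    smul_apply, SchwartzMap.smulLeftCLM_apply_apply (by fun_prop), inner_smul_left,
    EuclideanSpace.inner_single_right]
  have hpi : (Real.pi : ℂ) ≠ 0 := by exact_mod_cast Real.pi_ne_zero
  simp only [one_mul, conj_trivial, smul_eq_mul, Complex.real_smul, Complex.ofReal_mul,
    Complex.ofReal_inv, Complex.ofReal_ofNat]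
  field_simp

theorem charTransform_schwartzLaplacian (k : Rd d) (f : 𝓢(Rd d, ℂ)) (z : Rd d) :
    charTransform (schwartzLaplacian k f) z = fiberedSymbol k z * charTransform f z := by
  have hder : ∀ (i : Fin d) (g : 𝓢(Rd d, ℂ)),
      (𝓕⁻ (∂_{EuclideanSpace.single i (1 : ℝ)} g)) ((2 * Real.pi)⁻¹ • z)
        = -(Complex.I * z i) * (𝓕⁻ g) ((2 * Real.pi)⁻¹ • z) := fun i g => by
    rw [← charTransform_schwartz_eq, charTransform_lineDerivOp, charTransform_schwartz_eq]
  have hsymb : fiberedSymbol k z = ∑ i, z i ^ 2 + 2 * ∑ i, k i * z i := by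
    rw [fiberedSymbol, EuclideanSpace.real_norm_sq_eq, EuclideanSpace.real_norm_sq_eq,
      Finset.mul_sum, ← Finset.sum_add_distrib, ← Finset.sum_sub_distrib]
    refine Finset.sum_congr rfl fun i _ => ?_
    rw [PiLp.add_apply]
    ring
  rw [charTransform_schwartz_eq, charTransform_schwartz_eq, schwartzLaplacian,
    FourierTransform.fourierInv_add, FourierTransform.fourierInv_neg,
    FourierTransform.fourierInv_smul, FourierTransform.fourierInv_sum,
    FourierTransform.fourierInv_sum]
  simp only [FourierTransform.fourierInv_smul, add_apply, neg_apply, smul_apply, sum_apply,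
    hder, smul_eq_mul, hsymb]
  push_cast
  rw [Finset.mul_sum, Finset.mul_sum, add_mul, Finset.sum_mul, Finset.sum_mul,
    ← Finset.sum_neg_distrib, ← Finset.sum_add_distrib, ← Finset.sum_add_distrib]
  refine Finset.sum_congr rfl fun i _ => ?_
  linear_combination (-(z i : ℂ) ^ 2 - 2 * k i * z i) * (𝓕⁻ f) ((2 * Real.pi)⁻¹ • z) * Complex.I_sq

theorem contDiff_fiberedSymbol (k : Rd d) {n : WithTop ℕ∞} : ContDiff ℝ n (fiberedSymbol k) :=
  ((contDiff_id.add contDiff_const).norm_sq ℝ).sub contDiff_const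

/-- The shell `B_{|k|+ε}(-k) \ B_{|k|-ε}(-k)`. -/
abbrev shell (k : Rd d) (ε : ℝ) : Set (Rd d) :=
  Metric.ball (-k) (‖k‖ + ε) \ Metric.ball (-k) (‖k‖ - ε)

theorem mem_shell_iff {k z : Rd d} {ε : ℝ} :
    z ∈ shell k ε ↔ ‖z + k‖ < ‖k‖ + ε ∧ ‖k‖ - ε ≤ ‖z + k‖ := by
  simp [shell, dist_eq_norm]

/-- Factor the symbol as `(|z+k| - |k|)(|z+k| + |k|)`: the first factor is at most `ε` in size, the
second at most `2|k| + ε ≤ 3|k|`. -/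
theorem abs_fiberedSymbol_le_of_mem_shell {k z : Rd d} {ε : ℝ} (hε : ε ≤ ‖k‖)
    (hz : z ∈ shell k ε) : |fiberedSymbol k z| ≤ 3 * (‖k‖ * ε) := by
  rw [mem_shell_iff] at hz
  have h0 := norm_nonneg (z + k)
  rw [fiberedSymbol, abs_le]
  constructor <;> nlinarith

/-- In the same factorization the second factor is at least `|k|`. -/
theorem mem_shell_of_abs_fiberedSymbol_lt {k z : Rd d} (hk : k ≠ 0) {ε : ℝ} (hε : 0 < ε)
    (hz : |fiberedSymbol k z| < ‖k‖ * ε) : z ∈ shell k ε := by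
  have hk' := norm_pos_iff.2 hk
  have h0 := norm_nonneg (z + k)
  rw [fiberedSymbol, abs_lt] at hz
  rw [mem_shell_iff]
  constructor <;> nlinarith

/-- A smooth cutoff to a neighborhood of the sphere, as the transform of a Schwartz function. -/
theorem exists_schwartz_charTransform_shell {k : Rd d} (hk : k ≠ 0) {ε : ℝ} (hε : 0 < ε)
    (hεk : ε ≤ ‖k‖) :
    ∃ (f : 𝓢(Rd d, ℂ)) (χ : Rd d → ℝ), (∀ z, charTransform f z = χ z) ∧ (∀ z, 0 ≤ χ z) ∧
      (∀ z, χ z ≤ 1) ∧ (∀ z ∈ shell k ε, χ z = 1) ∧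
      ∀ z, χ z ≠ 0 → z ∈ shell k (4 * ε) ∧ |fiberedSymbol k z| ≤ 4 * (‖k‖ * ε) := by
  have hk' := norm_pos_iff.2 hk
  have hke : 0 < ‖k‖ * ε := mul_pos hk' hε
  -- The bump is applied to the symbol, which is smooth everywhere, rather than to `|z + k|`. The
  -- inner radius `3|k|ε` covers the symbol on the `ε`-shell; the outer radius `4|k|ε` confines the
  -- support to the `4ε`-shell.
  let b : ContDiffBump (0 : ℝ) := ⟨3 * (‖k‖ * ε), 4 * (‖k‖ * ε), by positivity, by linarith⟩
  have hsupp : ∀ z, b (fiberedSymbol k z) ≠ 0 → |fiberedSymbol k z| < 4 * (‖k‖ * ε) := by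
    intro z hz
    have h : fiberedSymbol k z ∈ Function.support b := hz
    rw [b.support_eq] at h
    simpa using h
  have hshell : ∀ z, b (fiberedSymbol k z) ≠ 0 → z ∈ shell k (4 * ε) := fun z hz =>
    mem_shell_of_abs_fiberedSymbol_lt hk (by positivity) (by linarith [hsupp z hz])
  -- The dilation by `2π` compensates for the normalization of `𝓕`.
  set g : Rd d → ℂ := fun w => (b (fiberedSymbol k ((2 * Real.pi) • w)) : ℂ) with hg
  have hgd : ContDiff ℝ (⊤ : ℕ∞) g :=
    Complex.ofRealCLM.contDiff.comp (b.contDiff.comp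
      ((contDiff_fiberedSymbol k).comp (contDiff_id.const_smul (2 * Real.pi))))
  have hgc : HasCompactSupport g := by
    refine HasCompactSupport.intro (isCompact_closedBall (0 : Rd d) (2 * ‖k‖ + 4 * ε))
      fun w hw => ?_
    by_contra hne
    have h1 := (mem_shell_iff.1 (hshell ((2 * Real.pi) • w) (fun h => hne (by simp [hg, h])))).1
    have h2 : ‖(2 * Real.pi) • w‖ ≤ ‖(2 * Real.pi) • w + k‖ + ‖k‖ := by
      simpa using norm_sub_le ((2 * Real.pi) • w + k) k
    rw [norm_smul, Real.norm_of_nonneg (by positivity)] at h2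
    have h3 : ‖w‖ ≤ 2 * Real.pi * ‖w‖ :=
      le_mul_of_one_le_left (norm_nonneg _) (by linarith [Real.pi_gt_three])
    refine hw ?_
    rw [mem_closedBall_zero_iff]
    linarith
  refine ⟨𝓕 (hgc.toSchwartzMap hgd), fun z => b (fiberedSymbol k z), fun z => ?_,
    fun z => b.nonneg, fun z => b.le_one, fun z hz => ?_, fun z hz => ⟨hshell z hz, (hsupp z hz).le⟩⟩
  · rw [charTransform_schwartz_eq, FourierTransform.fourierInv_fourier_eq]
    change g _ = _
    simp only [hg]
    rw [smul_inv_smul₀ (by positivity)]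
  · refine b.one_of_mem_closedBall ?_
    rw [mem_closedBall_zero_iff]
    exact abs_fiberedSymbol_le_of_mem_shell hεk hz

end Symbol

/-! ### Smallness of the spectral measure near the sphere -/

section Conclusion

variable {d : ℕ} {Ω : Type*} [MeasurableSpace Ω] [AddAction (Rd d) Ω] [MeasurableVAdd₂ (Rd d) Ω]
  {P : Measure Ω} [IsProbabilityMeasure P] [VAddInvariantMeasure (Rd d) Ω P]

/-- If `H_{k,0}^st ψ' = -V` has a weak solution in `L²(Ω)`, the spectral measure of `V` is small
near the sphere. -/
theorem measureReal_shell_sq_le {V : Ω → ℝ} (hV : MemLp V 2 P) {k : Rd d} (hk : k ≠ 0)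
    {ν : Measure (Rd d)} (hν : IsFourierTransformOf ν (covarianceFunction P V)) {ψ' : Lp ℂ 2 P}
    (hψ' : ∀ (φ : Lp ℂ 2 P) (h2 : φ ∈ H2 (d := d) P), φ ∈ LInfty P →
      inner ℂ (fiberedLaplacian P k ⟨φ, h2⟩) ψ' = -inner ℂ φ (potentialLp hV)) :
    ∃ A : ℝ, 0 ≤ A ∧ ∀ ε, 0 < ε → ε ≤ ‖k‖ →
      ν.real (shell k ε) ^ 2 ≤ A * ε ^ 2 * ν.real (shell k (4 * ε)) := by
  have := hν.1
  set c : ℝ := ((2 * Real.pi) ^ d)⁻¹ with hc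
  have hc0 : 0 < c := by positivity
  set v : Rd d → Lp ℂ 2 P := fun x => translation P x (potentialLp hV)
  have hv : ∀ x y, inner ℂ (v x) (v y) = c * charFun ν (y - x) := fun x y => by
    rw [inner_translation_potentialLp, hν.2, hc, Complex.ofReal_inv]
  have hv0 : v 0 = potentialLp hV := by
    apply Lp.ext
    filter_upwards [coeFn_translation P (0 : Rd d) (potentialLp hV)] with ω h
    rw [h, neg_zero, zero_vadd]
  -- Squaring `c ν(S_ε) ≤ ‖H w‖ ‖ψ'‖` and inserting `‖H w‖² ≤ c (4|k|ε)² ν(S_{4ε})` gives this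
  -- constant.
  refine ⟨‖ψ'‖ ^ 2 * 16 * ‖k‖ ^ 2 / c, by positivity, fun ε hε hεk => ?_⟩
  obtain ⟨f, χ, hfχ, hχ0, hχ1, hχs, hχ⟩ := exists_schwartz_charTransform_shell hk hε hεk
  have hweak : inner ℂ (∫ x, schwartzLaplacian k f x • v x) ψ' = -inner ℂ (∫ x, f x • v x) (v 0) := by
    rw [hv0, ← inner_neg_right]
    refine inner_integral_smul_translation_eq (fun φ hφ C hC => ?_)
      (continuous_of_inner_eq_charFun hv)
    rw [← fiberedLaplacian_mollifyLp, hψ' _ _ (mollifyLp_mem_LInfty hφ hC f), inner_neg_right]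
  have hχi : Integrable χ ν := by
    have h := (integrable_charTransform (ν := ν) f.integrable).re
    refine h.congr (Eventually.of_forall fun z => ?_)
    simp [hfχ]
  have hsm : ∀ ε : ℝ, MeasurableSet (shell k ε) := fun ε =>
    measurableSet_ball.diff measurableSet_ball
  have hlow : c * ν.real (shell k ε) ≤ ‖inner ℂ (∫ x, f x • v x) (v 0)‖ := by
    have h := inner_zero_integral_smul_eq hv f.integrable
    rw [norm_inner_symm]
    refine le_of_le_of_eq ?_ (congrArg norm h).symm
    simp only [hfχ]
    rw [integral_complex_ofReal, norm_mul, Complex.norm_of_nonneg hc0.le,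
      Complex.norm_of_nonneg (integral_nonneg hχ0)]
    gcongr
    calc ν.real (shell k ε) = ∫ z in shell k ε, χ z ∂ν := by
          rw [setIntegral_congr_fun (hsm ε) (g := fun _ => (1 : ℝ)) fun z hz => hχs z hz]
          simp
      _ ≤ ∫ z, χ z ∂ν := setIntegral_le_integral hχi (Eventually.of_forall hχ0)
  have hup : ‖∫ x, schwartzLaplacian k f x • v x‖ ^ 2
      ≤ c * ((4 * (‖k‖ * ε)) ^ 2 * ν.real (shell k (4 * ε))) := by
    refine (norm_integral_smul_sq_eq hv (schwartzLaplacian k f).integrable).trans_le ?_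
    gcongr
    calc ∫ z, ‖charTransform (schwartzLaplacian k f) z‖ ^ 2 ∂ν
        ≤ ∫ z, (shell k (4 * ε)).indicator (fun _ => (4 * (‖k‖ * ε)) ^ 2) z ∂ν := by
          refine integral_mono_of_nonneg (Eventually.of_forall fun _ => by positivity)
            ((integrable_const _).indicator (hsm _)) (Eventually.of_forall fun z => ?_)
          simp only [charTransform_schwartzLaplacian, hfχ]
          by_cases hz : χ z = 0
          · simp only [hz, Complex.ofReal_zero, mul_zero, norm_zero, ne_eq, OfNat.ofNat_ne_zero,
              not_false_eq_true, zero_pow]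
            exact indicator_nonneg (fun _ _ => by positivity) _
          · rw [indicator_of_mem (hχ z hz).1, norm_mul, Complex.norm_of_nonneg (hχ0 z),
              Complex.norm_real, Real.norm_eq_abs]
            exact pow_le_pow_left₀ (mul_nonneg (abs_nonneg _) (hχ0 z))
              ((mul_le_of_le_one_right (abs_nonneg _) (hχ1 z)).trans (hχ z hz).2) 2
      _ = (4 * (‖k‖ * ε)) ^ 2 * ν.real (shell k (4 * ε)) := by
          rw [integral_indicator_const _ (hsm _), smul_eq_mul, mul_comm]
  have hle : c * ν.real (shell k ε) ≤ ‖∫ x, schwartzLaplacian k f x • v x‖ * ‖ψ'‖ := by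
    refine hlow.trans ?_
    rw [← norm_neg, ← hweak]
    exact norm_inner_le_norm _ _
  have hsq := pow_le_pow_left₀ (by positivity) hle 2
  rw [mul_pow, mul_pow] at hsq
  have h3 := hsq.trans (mul_le_mul_of_nonneg_right hup (sq_nonneg ‖ψ'‖))
  have h4 : c ^ 2 * ν.real (shell k ε) ^ 2
      ≤ c ^ 2 * (‖ψ'‖ ^ 2 * 16 * ‖k‖ ^ 2 / c * ε ^ 2 * ν.real (shell k (4 * ε))) := by
    refine h3.trans (le_of_eq ?_)
    field_simp
    ring
  exact le_of_mul_le_mul_left h4 (by positivity)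

/-- A bounded function with `N(ε)² ≤ A ε² N(4ε)` is `o(ε)` at `0`. -/
theorem tendsto_div_of_sq_le {N : ℝ → ℝ} {A M r : ℝ} (hA : 0 ≤ A) (hr : 0 < r)
    (hN0 : ∀ ε, 0 ≤ N ε) (hNM : ∀ ε, N ε ≤ M)
    (hN : ∀ ε, 0 < ε → ε ≤ r → N ε ^ 2 ≤ A * ε ^ 2 * N (4 * ε)) :
    Tendsto (fun ε => N ε / ε) (𝓝[>] 0) (𝓝 0) := by
  have hlim : Tendsto (fun ε : ℝ => √(4 * A * √(A * M) * ε)) (𝓝[>] 0) (𝓝 0) := by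
    have h : Continuous fun ε : ℝ => √(4 * A * √(A * M) * ε) := by fun_prop
    simpa using (h.tendsto 0).mono_left nhdsWithin_le_nhds
  -- First pass: the crude bound `N(4ε) ≤ M` gives linear decay.
  have hlin : ∀ ε, 0 < ε → ε ≤ r → N ε ≤ ε * √(A * M) := by
    intro ε h0 h1
    rw [← Real.sqrt_sq (hN0 ε), ← Real.sqrt_sq h0.le, ← Real.sqrt_mul (sq_nonneg ε),
      Real.sqrt_sq h0.le]
    refine Real.sqrt_le_sqrt ((hN ε h0 h1).trans ?_)
    nlinarith [mul_le_mul_of_nonneg_left (hNM (4 * ε)) (mul_nonneg hA (sq_nonneg ε))]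
  refine squeeze_zero' ?_ ?_ hlim
  · filter_upwards [self_mem_nhdsWithin] with ε h0
    exact div_nonneg (hN0 ε) (le_of_lt h0)
  -- Second pass: the linear bound at `4ε`, available for `4ε ≤ r`, improves the estimate to
  -- `(N(ε)/ε)² = O(ε)`.
  · filter_upwards [Ioo_mem_nhdsGT (show (0 : ℝ) < r / 4 by positivity)] with ε h
    refine Real.le_sqrt_of_sq_le ?_
    rw [div_pow, div_le_iff₀ (pow_pos h.1 2)]
    refine (hN ε h.1 (by linarith [h.2])).trans ?_
    have h4 := mul_le_mul_of_nonneg_left (hlin (4 * ε) (by linarith [h.1]) (by linarith [h.2]))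
      (mul_nonneg hA (sq_nonneg ε))
    linarith

end Conclusion

end StationaryRandom

end

theorem mainTheorem4 {d : ℕ} {Ω : Type*} [MeasurableSpace Ω]
    [AddAction (StationaryRandom.Rd d) Ω] [MeasurableVAdd₂ (StationaryRandom.Rd d) Ω]
    (P : Measure Ω) [IsProbabilityMeasure P] [VAddInvariantMeasure (StationaryRandom.Rd d) Ω P]
    (V : Ω → ℝ) (hV : MemLp V 2 P) (hV0 : ∫ ω, V ω ∂P = 0)
    (k : StationaryRandom.Rd d) (hk : k ≠ 0)
    (hC : StationaryRandom.NonvanishingOnSphere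
      (StationaryRandom.fourierMeasure (StationaryRandom.covarianceFunction P V)) (-k) ‖k‖) :
    ¬ ∃ (δ : ℝ) (E : ℝ → ℝ) (ψ : ℝ → Lp ℂ 2 P),
      0 < δ ∧
      ContDiffOn ℝ 2 (fun lam => (E lam, ψ lam)) (Set.Ico 0 δ) ∧
      (∀ lam ∈ Set.Ico 0 δ,
        ∃ h : ψ lam ∈ (StationaryRandom.fiberedSchrodinger P hV k lam).domain,
          StationaryRandom.fiberedSchrodinger P hV k lam ⟨ψ lam, h⟩ = (E lam : ℂ) • ψ lam) ∧
      E 0 = 0 ∧ ψ 0 = Lp.const 2 P (1 : ℂ) := by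
  rintro ⟨δ, E, ψ, hδ, hcd, heq, hE0, hψ0⟩
  obtain ⟨ψ', hψ'⟩ := StationaryRandom.exists_weak_corrector hV hV0 k hδ
    (hcd.differentiableOn (by norm_num) 0 ⟨le_rfl, hδ⟩) heq hE0 hψ0
  obtain ⟨L, hL, hlim⟩ := hC
  by_cases hex : ∃ ν : Measure (StationaryRandom.Rd d),
      StationaryRandom.IsFourierTransformOf ν (StationaryRandom.covarianceFunction (d := d) P V)
  · have hν : StationaryRandom.IsFourierTransformOf
        (StationaryRandom.fourierMeasure (StationaryRandom.covarianceFunction (d := d) P V))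
        (StationaryRandom.covarianceFunction (d := d) P V) := by
      rw [StationaryRandom.fourierMeasure, dif_pos hex]
      exact hex.choose_spec
    set ν := StationaryRandom.fourierMeasure (StationaryRandom.covarianceFunction (d := d) P V)
    have := hν.1
    obtain ⟨A, hA, hAν⟩ := StationaryRandom.measureReal_shell_sq_le hV hk hν hψ'
    have h0 := StationaryRandom.tendsto_div_of_sq_le
      (N := fun ε => ν.real (StationaryRandom.shell k ε)) hA
      (norm_pos_iff.2 hk)
      (fun _ => measureReal_nonneg) (fun _ => measureReal_mono (subset_univ _)) hAν
    have h1 := ENNReal.tendsto_ofReal h0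
    rw [ENNReal.ofReal_zero] at h1
    refine hL.ne (tendsto_nhds_unique (h1.congr' ?_) hlim)
    filter_upwards [self_mem_nhdsWithin] with ε hε
    rw [ENNReal.ofReal_div_of_pos hε, ofReal_measureReal]
  -- Without a Fourier transform, the default measure `0` already contradicts the positive limit.
  · rw [StationaryRandom.fourierMeasure, dif_neg hex] at hlim
    simp only [Measure.coe_zero, Pi.zero_apply, ENNReal.zero_div] at hlim
    exact hL.ne (tendsto_nhds_unique tendsto_const_nhds hlim)
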